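/- **Proposition 12.6 (no direct factor $\mathbb{Z}/p$).** Let $p$ be a prime number and let $G$ be a profinite group. For a prime power $q=p^d$ ($d\ge 1$) write $H^i(G)=H^i(G,\mathbb{Z}/q)$ for the continuous cohomology with trivial action, and let $\beta_G\colon H^1(G)\to H^2(G)$ be the Bockstein homomorphism, i.e. the connecting homomorphism of $0\to\mathbb{Z}/q\to\mathbb{Z}/q^2\to\mathbb{Z}/q\to 0$. One says that $G$ has *Galois relation type* (with respect to $q$) if 1. the kernel of the homomorphism $H^1(G)\otimes_{\mathbb{Z}}H^1(G)\to H^2(G)$ induced by the cup product is generated by elements of the form $\psi\otimes\psi'$ with $\psi,\psi'\in H^1(G)$; 2. there exists $\xi\in H^1(G)$ such that $\psi\cup\xi+\beta_G(\psi)=0$ for every $\psi\in H^1(G)$; 3. the natural map $H^1(G,\mathbb{Z}/q)\to H^1(G,\mathbb{Z}/p^i)$ is surjective for every $1\le i\le d$. Take now $q=p$. Let $G^{(1)}=G$ and $G^{(i+1)}=(G^{(i)})^p[G^{(i)},G]$, the closed subgroup of $G$ generated by all $h^p$ and all $[h,g]=h^{-1}g^{-1}hg$ with $h\in G^{(i)}$,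 $g\in G$. Assume that $G$ has Galois relation type with respect to $q=p$ and, when $p=2$, that the maximal pro-$2$ quotient $G(2)$ of $G$ is not isomorphic to $\mathbb{Z}/2$. Then the profinite group $G/G^{(3)}$ has no direct factor isomorphic to $\mathbb{Z}/p$; that is, there is no topological group $K$ such that $G/G^{(3)}\cong(\mathbb{Z}/p)\times K$ as topological groups. -/

import Mathlib

open scoped TensorProduct

namespace ProfiniteGalois

section Cohomology

variable (G : Type*) [Group G] [TopologicalSpace G] (n : ℕ)

/-- `H¹(G, ℤ/n)` for the trivial action: the group of continuous homomorphisms `G → ℤ/n`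
(the continuous 1-cocycles; there are no nonzero 1-coboundaries). -/
def H1 : AddSubgroup (G → ZMod n) where
  carrier := {f | Continuous f ∧ ∀ g h, f (g * h) = f g + f h}
  zero_mem' := ⟨continuous_const, by simp⟩
  add_mem' := fun {a b} ha hb =>
    ⟨ha.1.add hb.1, fun g h => by simp only [Pi.add_apply, ha.2, hb.2]; abel⟩
  neg_mem' := fun {a} ha =>
    ⟨ha.1.neg, fun g h => by simp only [Pi.neg_apply, ha.2]; abel⟩

/-- Continuous (inhomogeneous) 2-cocycles `G × G → ℤ/n` for the trivial action. -/
def Z2 : AddSubgroup (G × G → ZMod n) where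
  carrier := {f | Continuous f ∧
    ∀ g h k, f (h, k) - f (g * h, k) + f (g, h * k) - f (g, h) = 0}
  zero_mem' := ⟨continuous_const, by simp⟩
  add_mem' := fun {a b} ha hb => ⟨ha.1.add hb.1, fun g h k => by
    have h1 := ha.2 g h k
    have h2 := hb.2 g h k
    simp only [Pi.add_apply]
    linear_combination h1 + h2⟩
  neg_mem' := fun {a} ha => ⟨ha.1.neg, fun g h k => by
    have h1 := ha.2 g h k
    simp only [Pi.neg_apply]
    linear_combination -h1⟩

/-- Continuous 2-coboundaries: the functions `(g, h) ↦ u(h) - u(gh) + u(g)` with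
`u : G → ℤ/n` continuous. -/
def B2 : AddSubgroup (G × G → ZMod n) where
  carrier := {f | ∃ u : G → ZMod n, Continuous u ∧
    ∀ g h, f (g, h) = u h - u (g * h) + u g}
  zero_mem' := ⟨0, continuous_const, by simp⟩
  add_mem' := by
    rintro a b ⟨u, hu, hu'⟩ ⟨v, hv, hv'⟩
    exact ⟨u + v, hu.add hv, fun g h => by simp only [Pi.add_apply, hu', hv']; abel⟩
  neg_mem' := by
    rintro a ⟨u, hu, hu'⟩
    exact ⟨-u, hu.neg, fun g h => by simp only [Pi.neg_apply, hu']; abel⟩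

/-- `H²(G, ℤ/n)` for the trivial action: continuous 2-cocycles modulo 2-coboundaries. -/
abbrev H2 : Type _ := Z2 G n ⧸ (B2 G n).addSubgroupOf (Z2 G n)

variable {G n}

/-- The cohomology class of a continuous 2-cocycle. -/
def H2.mk (f : Z2 G n) : H2 G n := QuotientAddGroup.mk f

/-- The 2-cocycle `(g, h) ↦ ψ(g) ψ'(h)` representing the cup product of `ψ` and `ψ'`. -/
def cupCocycle (ψ ψ' : H1 G n) : Z2 G n :=
  ⟨fun x => ψ.1 x.1 * ψ'.1 x.2,
    (ψ.2.1.comp continuous_fst).mul (ψ'.2.1.comp continuous_snd),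
    fun g h k => by
      simp only [ψ.2.2, ψ'.2.2]
      ring⟩

/-- The cup product `H¹(G, ℤ/n) × H¹(G, ℤ/n) → H²(G, ℤ/n)`. -/
def cup (ψ ψ' : H1 G n) : H2 G n := H2.mk (cupCocycle ψ ψ')

variable (G n) in
/-- The cup product as a bi-additive map. -/
def cupBilin : H1 G n →ₗ[ℤ] H1 G n →ₗ[ℤ] H2 G n :=
  LinearMap.mk₂ ℤ cup
    (fun a b c => by
      refine congrArg H2.mk (Subtype.ext (funext fun x => ?_))
      exact add_mul _ _ _)
    (fun m a b => by
      refine congrArg H2.mk (Subtype.ext (funext fun x => ?_))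
      exact smul_mul_assoc m (a.1 x.1) (b.1 x.2))
    (fun a b c => by
      refine congrArg H2.mk (Subtype.ext (funext fun x => ?_))
      exact mul_add _ _ _)
    (fun m a b => by
      refine congrArg H2.mk (Subtype.ext (funext fun x => ?_))
      exact mul_smul_comm m (a.1 x.1) (b.1 x.2))

variable (G n) in
/-- The homomorphism `H¹(G, ℤ/n) ⊗_ℤ H¹(G, ℤ/n) → H²(G, ℤ/n)` induced by the cup product. -/
noncomputable def cupHom : H1 G n ⊗[ℤ] H1 G n →ₗ[ℤ] H2 G n :=
  TensorProduct.lift (cupBilin G n)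

/-- The map `H¹(G, ℤ/n) → H¹(G, ℤ/m)` induced by the projection `ℤ/n → ℤ/m`, for `m ∣ n`. -/
def reduce {m : ℕ} (hm : m ∣ n) (ψ : H1 G n) : H1 G m :=
  ⟨fun g => ZMod.castHom hm (ZMod m) (ψ.1 g),
    continuous_of_discreteTopology.comp ψ.2.1,
    fun g h => by simp only [ψ.2.2, map_add]⟩

/-- The connecting homomorphism `H¹(G, ℤ/n) → H²(G, ℤ/n)` of `0 → ℤ/n → ℤ/n² → ℤ/n → 0` is
computed with the set-theoretic section of `ℤ/n² → ℤ/n` that takes a class to its representative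
in `{0, …, n - 1}`. The coboundary of the lifted cochain is `n` times the cochain
`(g, h) ↦ ⌊(ψ(g) + ψ(h)) / n⌋` (see `bocksteinFun_spec`). -/
def bocksteinFun (ψ : H1 G n) (x : G × G) : ZMod n :=
  (((ψ.1 x.1).val + (ψ.1 x.2).val) / n : ℕ)

/-- The image of `bocksteinFun ψ` under the inclusion `ℤ/n → ℤ/n²`, `a ↦ n a`, is the coboundary
of the lift of `ψ` to `ℤ/n²`. -/
theorem bocksteinFun_spec [NeZero n] (ψ : H1 G n) (g h : G) :
    (n : ZMod (n * n)) * ((bocksteinFun ψ (g, h)).val : ZMod (n * n)) =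
      ((ψ.1 h).val : ZMod (n * n)) - ((ψ.1 (g * h)).val : ZMod (n * n))
        + ((ψ.1 g).val : ZMod (n * n)) := by
  have hn : 0 < n := Nat.pos_of_ne_zero (NeZero.ne n)
  have hlt : ((ψ.1 g).val + (ψ.1 h).val) / n < n ∨ n = 1 := by
    have h1 := ZMod.val_lt (ψ.1 g)
    have h2 := ZMod.val_lt (ψ.1 h)
    rcases Nat.lt_or_ge 1 n with h3 | h3
    · left
      refine (Nat.div_lt_iff_lt_mul hn).2 ?_
      nlinarith
    · right; omega
  rcases hlt with hlt | rfl
  · have hv : (bocksteinFun ψ (g, h)).val = ((ψ.1 g).val + (ψ.1 h).val) / n := by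
      simp only [bocksteinFun]
      rw [ZMod.val_natCast, Nat.mod_eq_of_lt hlt]
    rw [hv, ψ.2.2, ZMod.val_add]
    have := Nat.div_add_mod ((ψ.1 g).val + (ψ.1 h).val) n
    have h4 := congrArg (Nat.cast : ℕ → ZMod (n * n)) this
    push_cast at h4 ⊢
    linear_combination h4
  · exact Subsingleton.elim (α := ZMod 1) _ _

/-- The cochain `bocksteinFun ψ` is a continuous 2-cocycle. -/
def bocksteinCocycle [NeZero n] (ψ : H1 G n) : Z2 G n :=
  ⟨bocksteinFun ψ, by
    have h : Continuous fun x : G × G => (ψ.1 x.1, ψ.1 x.2) :=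
      (ψ.2.1.comp continuous_fst).prodMk (ψ.2.1.comp continuous_snd)
    exact (continuous_of_discreteTopology
      (f := fun y : ZMod n × ZMod n => (((y.1.val + y.2.val) / n : ℕ) : ZMod n))).comp h,
    fun g h k => by
      have hn : 0 < n := Nat.pos_of_ne_zero (NeZero.ne n)
      have key : ∀ x y z : ℕ, (y + z) / n + (x + (y + z) % n) / n
          = ((x + y) % n + z) / n + (x + y) / n := by
        intro x y z
        have e1 : (x + y + z) / n = (y + z) / n + (x + (y + z) % n) / n := by
          conv_lhs => rw [add_assoc, ← Nat.div_add_mod (y + z) n, add_left_comm,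
            Nat.mul_add_div hn]
        have e2 : (x + y + z) / n = (x + y) / n + ((x + y) % n + z) / n := by
          conv_lhs => rw [← Nat.div_add_mod (x + y) n, add_assoc, Nat.mul_add_div hn]
        omega
      have := congrArg (Nat.cast : ℕ → ZMod n)
        (key (ψ.1 g).val (ψ.1 h).val (ψ.1 k).val)
      simp only [bocksteinFun, ψ.2.2, ZMod.val_add]
      rw [Nat.cast_add, Nat.cast_add] at this
      linear_combination this⟩

/-- The Bockstein map `β_G : H¹(G, ℤ/n) → H²(G, ℤ/n)`, the connecting homomorphism of
`0 → ℤ/n → ℤ/n² → ℤ/n → 0`. -/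
def bockstein [NeZero n] (ψ : H1 G n) : H2 G n := H2.mk (bocksteinCocycle ψ)

end Cohomology

/-- `G` has Galois relation type with respect to the power `q` of the prime `p`. -/
structure HasGaloisRelationType (p q : ℕ) [NeZero q] (G : Type*) [Group G] [TopologicalSpace G] :
    Prop where
  /-- The kernel of the cup product homomorphism is generated by elements `ψ ⊗ ψ'`. -/
  ker_cup : LinearMap.ker (cupHom G q) =
    Submodule.span ℤ {t | t ∈ LinearMap.ker (cupHom G q) ∧ ∃ ψ ψ' : H1 G q, t = ψ ⊗ₜ[ℤ] ψ'}
  /-- There is `ξ` with `ψ ∪ ξ + β_G(ψ) = 0` for every `ψ`. -/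
  exists_xi : ∃ ξ : H1 G q, ∀ ψ : H1 G q, cup ψ ξ + bockstein ψ = 0
  /-- `H¹(G, ℤ/q) → H¹(G, ℤ/p^i)` is surjective whenever `1 ≤ i` and `p^i ∣ q`. -/
  reduce_surjective : ∀ i : ℕ, 1 ≤ i → ∀ hi : p ^ i ∣ q,
    Function.Surjective (reduce hi : H1 G q → H1 G (p ^ i))

section Subgroups

variable (G : Type*) [Group G] [TopologicalSpace G] [IsTopologicalGroup G]

/-- The closed subgroup `N^q [N, G]`, topologically generated by all `h^q` and all
`[h, g] = h⁻¹ g⁻¹ h g` with `h ∈ N`, `g ∈ G`. -/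
def powCommutator {G : Type*} [Group G] [TopologicalSpace G] [IsTopologicalGroup G]
    (q : ℕ) (N : Subgroup G) : Subgroup G :=
  (Subgroup.closure ({x | ∃ h ∈ N, x = h ^ q} ∪
    {x | ∃ h ∈ N, ∃ g : G, x = h⁻¹ * g⁻¹ * h * g})).topologicalClosure

/-- The descending `q`-central sequence: `G^(1) = G`, `G^(i+1) = (G^(i))^q [G^(i), G]`
(with the convention `G^(0) = G`, which is not used). -/
def descCentral (q : ℕ) : ℕ → Subgroup G
  | 0 => ⊤
  | 1 => ⊤
  | i + 2 => powCommutator q (descCentral q (i + 1))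

theorem powCommutator_normal {G : Type*} [Group G] [TopologicalSpace G] [IsTopologicalGroup G]
    (q : ℕ) (N : Subgroup G) [hN : N.Normal] : (powCommutator q N).Normal := by
  have key : (Subgroup.closure ({x | ∃ h ∈ N, x = h ^ q} ∪
      {x | ∃ h ∈ N, ∃ g : G, x = h⁻¹ * g⁻¹ * h * g})).Normal := by
    refine ⟨fun x hx a => ?_⟩
    induction hx using Subgroup.closure_induction with
    | mem x hx =>
      refine Subgroup.subset_closure ?_
      rcases hx with ⟨h, hh, rfl⟩ | ⟨h, hh, g, rfl⟩
      · exact Or.inl ⟨a * h * a⁻¹, hN.conj_mem h hh a, by simp⟩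
      · exact Or.inr ⟨a * h * a⁻¹, hN.conj_mem h hh a, a * g * a⁻¹, by group⟩
    | one => simp
    | mul x y _ _ hx hy => simpa [mul_assoc] using mul_mem hx hy
    | inv x _ hx => simpa [mul_assoc] using inv_mem hx
  exact Subgroup.is_normal_topologicalClosure _

instance descCentral_normal (q i : ℕ) : (descCentral G q i).Normal := by
  induction i with
  | zero => exact (inferInstance : (⊤ : Subgroup G).Normal)
  | succ i ih =>
    cases i with
    | zero => exact (inferInstance : (⊤ : Subgroup G).Normal)
    | succ i => exact powCommutator_normal q (descCentral G q (i + 1))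

/-- The kernel of the projection of a profinite group `G` onto its maximal pro-`p` quotient: the
intersection of all open normal subgroups whose index is a power of `p`. -/
def maxProPKernel (p : ℕ) : Subgroup G :=
  sInf {N : Subgroup G | N.Normal ∧ IsOpen (N : Set G) ∧ ∃ k : ℕ, N.index = p ^ k}

instance maxProPKernel_normal (p : ℕ) : (maxProPKernel G p).Normal := by
  refine ⟨fun x hx g => ?_⟩
  simp only [maxProPKernel, Subgroup.mem_sInf, Set.mem_ofPred_eq] at hx ⊢
  exact fun N hN => hN.1.conj_mem x (hx N hN) g

/-- The maximal pro-`p` quotient `G(p)` of a profinite group `G`. -/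
abbrev MaxProPQuotient (p : ℕ) : Type _ := G ⧸ maxProPKernel G p

end Subgroups

end ProfiniteGalois

/-! A direct factor `ℤ/p` supplies `s` in `G`, central modulo `G^(3)` with `s ^ p` in `G^(3)`, and a
character `χ` with `χ(s) = 1`. Each relation `ψ ∪ ξ + β(ψ) = 0` is witnessed by a cochain `u` that
factors through `G / G^(3)` (`exists_cochain`), so it can be tested on `s`.

For `ψ = χ`, summing the cocycle over `(s, s ^ i)`, `i < p`, gives `(∑ i) ξ(s) + 1 = 0`
(`sum_range_mul_add_one_eq_zero`). For odd `p` the sum over `i` is `0` in `ℤ/p`, a contradiction.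

For `p = 2` it gives `ξ(s) = 1`. Comparing the cocycle at `(g, s)` and `(s, g)` then shows that a
character vanishing at `s` is zero (`eq_zero_of_apply_eq_zero`). By a Frattini argument `s`
generates every finite `2`-quotient (`zpowers_mk_eq_top`), where `G^(3)` becomes `⟨s ^ 4⟩`; as `s ^
2` lies there, it is trivial. Hence `G(2)` is `ℤ/2`, the excluded case. -/

namespace ProfiniteGalois

/-! ### Characters, and cochains modulo `G^(3)`. -/

section General

variable {G : Type*} [Group G] [TopologicalSpace G]

namespace H1

variable {n : ℕ} (ψ : H1 G n)

theorem map_mul (g h : G) : ψ.1 (g * h) = ψ.1 g + ψ.1 h := ψ.2.2 g h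

theorem map_one : ψ.1 1 = 0 := by
  simpa using (H1.map_mul ψ) 1 1

theorem map_inv (g : G) : ψ.1 g⁻¹ = -ψ.1 g := by
  have h := (H1.map_mul ψ) g⁻¹ g
  rw [inv_mul_cancel, (H1.map_one ψ)] at h
  linear_combination -h

theorem map_pow (g : G) (i : ℕ) : ψ.1 (g ^ i) = i * ψ.1 g := by
  induction i with
  | zero => simp [(H1.map_one ψ)]
  | succ i ih => rw [pow_succ, (H1.map_mul ψ), ih]; push_cast; ring

/-- The kernel of a continuous character. -/
def ker : Subgroup G where
  carrier := {g | ψ.1 g = 0}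
  one_mem' := (H1.map_one ψ)
  mul_mem' := fun {a b} ha hb => by
    simp only [Set.mem_ofPred_eq] at ha hb ⊢
    rw [(H1.map_mul ψ), ha, hb, add_zero]
  inv_mem' := fun {a} ha => by
    simp only [Set.mem_ofPred_eq] at ha ⊢
    rw [(H1.map_inv ψ), ha, neg_zero]

variable {ψ} in
theorem mem_ker {g : G} : g ∈ H1.ker ψ ↔ ψ.1 g = 0 := Iff.rfl

theorem isOpen_ker : IsOpen (H1.ker ψ : Set G) :=
  (isOpen_discrete ({0} : Set (ZMod n))).preimage ψ.2.1

theorem isClosed_ker : IsClosed (H1.ker ψ : Set G) :=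
  (isClosed_discrete ({0} : Set (ZMod n))).preimage ψ.2.1

end H1

omit [TopologicalSpace G] in
/-- A coboundary summed along the powers of an element of `G` telescopes. -/
theorem sum_coboundary_pow {A : Type*} [AddCommGroup A] {f : G × G → A} {u : G → A}
    (hu : ∀ g h, f (g, h) = u h - u (g * h) + u g) (g : G) (m : ℕ) :
    ∑ i ∈ Finset.range m, f (g, g ^ i) = u 1 - u (g ^ m) + m • u g := by
  induction m with
  | zero => simp
  | succ m ih =>
    rw [Finset.sum_range_succ, ih, hu, ← pow_succ', succ_nsmul]
    abel

variable [IsTopologicalGroup G]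

theorem powCommutator_le {q : ℕ} {N M : Subgroup G} (hM : IsClosed (M : Set G))
    (hpow : ∀ h ∈ N, h ^ q ∈ M) (hcomm : ∀ h ∈ N, ∀ g : G, h⁻¹ * g⁻¹ * h * g ∈ M) :
    powCommutator q N ≤ M := by
  refine Subgroup.topologicalClosure_minimal _ ?_ hM
  rw [Subgroup.closure_le]
  rintro x (⟨h, hh, rfl⟩ | ⟨h, hh, g, rfl⟩)
  exacts [hpow h hh, hcomm h hh g]

theorem descCentral_two_le_ker {n : ℕ} (ψ : H1 G n) : descCentral G n 2 ≤ H1.ker ψ := by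
  refine powCommutator_le (H1.isClosed_ker ψ) (fun h _ => ?_) (fun h _ g => ?_)
  · rw [H1.mem_ker, (H1.map_pow ψ), ZMod.natCast_self, zero_mul]
  · simp only [H1.mem_ker, (H1.map_mul ψ), (H1.map_inv ψ)]
    ring

/-- A cochain whose coboundary vanishes as soon as one argument lies in `G^(2)` is invariant
under `G^(3)`. -/
theorem cochain_mul_descCentral_three {n : ℕ} {u : G → ZMod n} (hc : Continuous u)
    (hl : ∀ g ∈ descCentral G n 2, ∀ h, u (g * h) = u g + u h)
    (hr : ∀ g, ∀ h ∈ descCentral G n 2, u (g * h) = u g + u h)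
    {c : G} (hcm : c ∈ descCentral G n 3) : u c = 0 ∧ ∀ g, u (g * c) = u g := by
  have h1 : u 1 = 0 := by simpa using hl 1 (one_mem _) 1
  have hinv : ∀ a ∈ descCentral G n 2, u a⁻¹ = -u a := fun a ha => by
    have := hl a ha a⁻¹
    rw [mul_inv_cancel, h1] at this
    linear_combination -this
  -- The zeros of `u` in `G^(2)` form a closed subgroup, so only the generators of `G^(3)` need
  -- checking.
  let M : Subgroup G :=
    { carrier := {x | x ∈ descCentral G n 2 ∧ u x = 0}
      one_mem' := ⟨one_mem _, h1⟩
      mul_mem' := fun {a b} ha hb => ⟨mul_mem ha.1 hb.1, by rw [hl a ha.1, ha.2, hb.2, add_zero]⟩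
      inv_mem' := fun {a} ha => ⟨inv_mem ha.1, by rw [hinv a ha.1, ha.2, neg_zero]⟩ }
  have hMc : IsClosed (M : Set G) :=
    (Subgroup.isClosed_topologicalClosure _ : IsClosed (descCentral G n 2 : Set G)).inter
      ((isClosed_discrete ({0} : Set (ZMod n))).preimage hc)
  have hle : descCentral G n 3 ≤ M := by
    refine powCommutator_le hMc (fun h hh => ⟨pow_mem hh _, ?_⟩) (fun h hh g => ?_)
    · have : ∀ i : ℕ, u (h ^ i) = i * u h := fun i => by
        induction i with
        | zero => simp [h1]
        | succ i ih => rw [pow_succ, hr _ _ hh, ih]; push_cast; ring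
      rw [this, ZMod.natCast_self, zero_mul]
    · have hconj : g⁻¹ * h * g ∈ descCentral G n 2 := by
        simpa using (descCentral_normal G n 2).conj_mem h hh g⁻¹
      -- Expand `u (h * g)` in two ways, with the `G^(2)` factor on the left and on the right.
      have hu : u (g⁻¹ * h * g) = u h := by
        have e1 := hr g _ hconj
        rw [show g * (g⁻¹ * h * g) = h * g by group, hl h hh] at e1
        linear_combination -e1
      rw [show h⁻¹ * g⁻¹ * h * g = h⁻¹ * (g⁻¹ * h * g) by group]
      exact ⟨mul_mem (inv_mem hh) hconj, by rw [hl _ (inv_mem hh), hinv h hh, hu, neg_add_cancel]⟩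
  obtain ⟨hc2, hc0⟩ := hle hcm
  exact ⟨hc0, fun g => by rw [hr g c hc2, hc0, add_zero]⟩

/-- If `ψ ∪ ξ + β(ψ) = 0` then the representing cocycle is the coboundary of a cochain that
factors through `G / G^(3)`. -/
theorem exists_cochain {n : ℕ} [NeZero n] {ψ ξ : H1 G n} (h : cup ψ ξ + bockstein ψ = 0) :
    ∃ u : G → ZMod n,
      (∀ g h, ψ.1 g * ξ.1 h + bocksteinFun ψ (g, h) = u h - u (g * h) + u g) ∧
      ∀ c ∈ descCentral G n 3, u c = 0 ∧ ∀ g, u (g * c) = u g := by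
  have h' : (QuotientAddGroup.mk (cupCocycle ψ ξ + bocksteinCocycle ψ) : H2 G n) = 0 := h
  rw [QuotientAddGroup.eq_zero_iff, AddSubgroup.mem_addSubgroupOf] at h'
  obtain ⟨u, hu, hf⟩ := h'
  have hf : ∀ g h, ψ.1 g * ξ.1 h + bocksteinFun ψ (g, h) = u h - u (g * h) + u g := hf
  refine ⟨u, hf, fun c hc => cochain_mul_descCentral_three hu (fun g hg h => ?_)
    (fun g h hh => ?_) hc⟩
  · have e := hf g h
    have h0 : ψ.1 g = 0 := descCentral_two_le_ker ψ hg
    simp only [bocksteinFun, h0, ZMod.val_zero, zero_add, zero_mul,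
      Nat.div_eq_of_lt (ZMod.val_lt (ψ.1 h)), Nat.cast_zero] at e
    linear_combination e
  · have e := hf g h
    have h0 : ψ.1 h = 0 := descCentral_two_le_ker ψ hh
    have h1 : ξ.1 h = 0 := descCentral_two_le_ker ξ hh
    simp only [bocksteinFun, h0, h1, ZMod.val_zero, add_zero, mul_zero,
      Nat.div_eq_of_lt (ZMod.val_lt (ψ.1 g)), Nat.cast_zero] at e
    linear_combination e

/-- Restriction of the relation `χ ∪ ξ + β(χ) = 0` to an element of order `n` in `G / G^(3)` on
which `χ` takes the value `1`. -/
theorem sum_range_mul_add_one_eq_zero {n : ℕ} [Fact (1 < n)] [NeZero n] {χ ξ : H1 G n}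
    (h : cup χ ξ + bockstein χ = 0) {s : G} (hs : χ.1 s = 1)
    (hsn : s ^ n ∈ descCentral G n 3) :
    (∑ i ∈ Finset.range n, (i : ZMod n)) * ξ.1 s + 1 = 0 := by
  obtain ⟨u, hf, hu⟩ := exists_cochain h
  have hsum := sum_coboundary_pow
    (f := fun x => χ.1 x.1 * ξ.1 x.2 + bocksteinFun χ x) hf s n
  rw [(hu _ (one_mem _)).1, (hu _ hsn).1, sub_zero, zero_add, nsmul_eq_mul,
    ZMod.natCast_self, zero_mul, Finset.sum_add_distrib] at hsum
  -- The term at `i` is the carry of `1 + i` modulo `n`, nonzero only for `i = n - 1`.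
  have hbock : ∑ i ∈ Finset.range n, bocksteinFun χ (s, s ^ i) = 1 := by
    have hn : 1 < n := Fact.out
    rw [Finset.sum_eq_single (n - 1)]
    · simp only [bocksteinFun, (H1.map_pow χ), hs, mul_one, ZMod.val_natCast, ZMod.val_one]
      rw [Nat.mod_eq_of_lt (by omega), show 1 + (n - 1) = n by omega, Nat.div_self (by omega)]
      exact Nat.cast_one
    · intro i hi hne
      rw [Finset.mem_range] at hi
      simp only [bocksteinFun, (H1.map_pow χ), hs, mul_one, ZMod.val_natCast, ZMod.val_one]
      rw [Nat.mod_eq_of_lt hi, Nat.div_eq_of_lt (by omega), Nat.cast_zero]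
    · intro hi
      exact absurd (Finset.mem_range.2 (by omega)) hi
  rw [hbock] at hsum
  simpa [hs, (H1.map_pow ξ), Finset.sum_mul] using hsum

end General

/-! ### The case `p = 2`: finite `2`-quotients. -/

section Two

variable {G : Type*} [Group G] [TopologicalSpace G] [IsTopologicalGroup G]

/-- If `s` is central modulo `G^(3)` and `ξ(s) = 1`, then the relation `ψ ∪ ξ + β(ψ) = 0` forces
`ψ = 0` whenever `ψ(s) = 0`. -/
theorem eq_zero_of_apply_eq_zero {ψ ξ : H1 G 2} (h : cup ψ ξ + bockstein ψ = 0) {s : G}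
    (hξ : ξ.1 s = 1) (hcent : ∀ g, (g * s)⁻¹ * (s * g) ∈ descCentral G 2 3) (hψ : ψ.1 s = 0)
    (g : G) : ψ.1 g = 0 := by
  obtain ⟨u, hf, hu⟩ := exists_cochain h
  have hcomm : u (s * g) = u (g * s) := by
    rw [← (hu _ (hcent g)).2 (g * s), mul_inv_cancel_left]
  have e1 := hf g s
  have e2 := hf s g
  -- Adding `ψ(s) = 0` produces no carry, so both Bockstein terms vanish; the cup product term is
  -- `ψ(g)` at `(g, s)` and `0` at `(s, g)`.
  simp only [bocksteinFun, hψ, hξ, ZMod.val_zero, add_zero, zero_add, mul_one, zero_mul,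
    Nat.div_eq_of_lt (ZMod.val_lt (ψ.1 g)), Nat.cast_zero] at e1 e2
  linear_combination e1 - e2 + hcomm

/-- The character with kernel a given open subgroup of index two. -/
theorem exists_H1_of_index_two {M : Subgroup G} (hM : IsOpen (M : Set G)) (hi : M.index = 2) :
    ∃ ψ : H1 G 2, ∀ g, ψ.1 g = 0 ↔ g ∈ M := by
  classical
  refine ⟨⟨fun g => if g ∈ M then 0 else 1, ?_, fun g h => ?_⟩, fun g => ?_⟩
  · have hcl : IsClopen (M : Set G) := ⟨M.isClosed_of_isOpen hM, hM⟩
    exact continuous_const.if (fun a ha => by simp [hcl.frontier_eq] at ha) continuous_const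
  · have := Subgroup.mul_mem_iff_of_index_two hi (a := g) (b := h)
    by_cases hg : g ∈ M <;> by_cases hh : h ∈ M <;> simp [this, hg, hh]
    decide
  · by_cases hg : g ∈ M <;> simp [hg]

/-- If no nonzero character vanishes at `s`, then `s` generates every finite `2`-quotient. -/
theorem zpowers_mk_eq_top {s : G} (hs : ∀ ψ : H1 G 2, ψ.1 s = 0 → ∀ g, ψ.1 g = 0)
    {N : Subgroup G} [N.Normal] (hN : IsOpen (N : Set G)) {k : ℕ} (hk : N.index = 2 ^ k) :
    Subgroup.zpowers (s : G ⧸ N) = ⊤ := by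
  have hcard : Nat.card (G ⧸ N) = 2 ^ k := hk
  have : Finite (G ⧸ N) := Nat.finite_of_card_ne_zero (by rw [hcard]; positivity)
  by_contra hne
  obtain ⟨j, hjk, hj⟩ := (Nat.dvd_prime_pow Nat.prime_two).1
    (hcard ▸ Subgroup.card_subgroup_dvd_card (Subgroup.zpowers (s : G ⧸ N)))
  have hlt : j < k := by
    refine lt_of_le_of_ne hjk fun e => hne ?_
    exact Subgroup.eq_top_of_card_eq _ (by rw [hj, hcard, e])
  have : Fact (Nat.Prime 2) := ⟨Nat.prime_two⟩
  -- A proper subgroup of a `2`-group lies in one of index two, whose character would vanish at `s`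
  -- without being zero.
  obtain ⟨M, hMc, hle⟩ := Sylow.exists_subgroup_card_pow_prime_le 2 (n := j) (m := k - 1)
    (hcard ▸ pow_dvd_pow 2 (by omega)) (Subgroup.zpowers (s : G ⧸ N)) hj (by omega)
  have hMi : M.index = 2 := by
    have := M.card_mul_index
    rw [hMc, hcard, show k = k - 1 + 1 by omega, pow_succ, Nat.add_sub_cancel] at this
    exact Nat.eq_of_mul_eq_mul_left (by positivity) this
  have hM' : (M.comap (QuotientGroup.mk' N)).index = 2 := by
    rw [Subgroup.index_comap_of_surjective _ (QuotientGroup.mk'_surjective N), hMi]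
  have hNM : N ≤ M.comap (QuotientGroup.mk' N) := fun x hx => by
    rw [Subgroup.mem_comap, QuotientGroup.mk'_apply, (QuotientGroup.eq_one_iff x).2 hx]
    exact one_mem _
  obtain ⟨ψ, hψ⟩ := exists_H1_of_index_two (Subgroup.isOpen_mono hNM hN) hM'
  have htop : M.comap (QuotientGroup.mk' N) = ⊤ := by
    rw [eq_top_iff]
    intro g _
    exact (hψ g).1 (hs ψ ((hψ s).2 (hle (Subgroup.mem_zpowers _))) g)
  rw [htop, Subgroup.index_top] at hM'
  omega

/-- The quotient is cyclic, hence abelian: commutators die, and each step of the series only takes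
`q`-th powers. -/
theorem descCentral_succ_le_comap_zpowers {s : G} {N : Subgroup G} [N.Normal]
    (hN : IsOpen (N : Set G)) (htop : Subgroup.zpowers (s : G ⧸ N) = ⊤) (q i : ℕ) :
    descCentral G q (i + 1) ≤
      (Subgroup.zpowers ((s : G ⧸ N) ^ q ^ i)).comap (QuotientGroup.mk' N) := by
  induction i with
  | zero =>
    rw [pow_zero, pow_one, htop]
    exact le_top
  | succ i ih =>
    have hle : N ≤ (Subgroup.zpowers ((s : G ⧸ N) ^ q ^ (i + 1))).comap (QuotientGroup.mk' N) :=
      fun x hx => by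
        rw [Subgroup.mem_comap, QuotientGroup.mk'_apply, (QuotientGroup.eq_one_iff x).2 hx]
        exact one_mem _
    refine powCommutator_le (Subgroup.isClosed_of_isOpen _ (Subgroup.isOpen_mono hle hN))
      (fun h hh => ?_) (fun h _ g => ?_)
    · obtain ⟨m, hm⟩ := Subgroup.mem_zpowers_iff.1 (ih hh)
      refine Subgroup.mem_zpowers_iff.2 ⟨m, ?_⟩
      rw [_root_.map_pow, ← hm, pow_succ, pow_mul, ← zpow_natCast _ q, ← zpow_natCast _ q,
        ← zpow_mul, ← zpow_mul, mul_comm (q : ℤ)]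
    · obtain ⟨a, ha⟩ := Subgroup.mem_zpowers_iff.1 (htop ▸ Subgroup.mem_top (h : G ⧸ N))
      obtain ⟨b, hb⟩ := Subgroup.mem_zpowers_iff.1 (htop ▸ Subgroup.mem_top (g : G ⧸ N))
      rw [Subgroup.mem_comap]
      have : (QuotientGroup.mk' N) (h⁻¹ * g⁻¹ * h * g) = 1 := by
        simp only [_root_.map_mul, _root_.map_inv, QuotientGroup.mk'_apply]
        rw [← ha, ← hb]
        group
      rw [this]
      exact one_mem _

/-- Modulo `N`, `s ^ 2` is a power `(s ^ 4) ^ m`, so it is killed by the odd number `1 - 2 * m` as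
well as by a power of `2`. -/
theorem sq_mem_of_sq_mem_descCentral {s : G} {N : Subgroup G} [N.Normal]
    (hN : IsOpen (N : Set G)) {k : ℕ} (hk : N.index = 2 ^ k)
    (htop : Subgroup.zpowers (s : G ⧸ N) = ⊤) (hs2 : s ^ 2 ∈ descCentral G 2 3) :
    s ^ 2 ∈ N := by
  obtain ⟨m, hm⟩ := Subgroup.mem_zpowers_iff.1 (descCentral_succ_le_comap_zpowers hN htop 2 2 hs2)
  rw [← QuotientGroup.eq_one_iff, QuotientGroup.mk_pow]
  have hm' : ((s : G ⧸ N) ^ 2) ^ (1 - 2 * m) = 1 := by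
    have e : ((s : G ⧸ N) ^ 2) ^ (2 * m) = (s : G ⧸ N) ^ 2 := by
      rw [zpow_mul]
      refine Eq.trans (congrArg (· ^ m) ?_) hm
      norm_cast
      rw [← pow_mul, ← sq]
    rw [zpow_sub, e, zpow_one, mul_inv_cancel]
  have hpow : ((s : G ⧸ N) ^ 2) ^ (2 ^ k) = 1 := by
    rw [← hk]
    exact pow_card_eq_one'
  have hcop : IsCoprime (1 - 2 * m) ((2 : ℤ) ^ k) := by
    refine IsCoprime.pow_right ⟨1, m, by ring⟩
  obtain ⟨a, b, hab⟩ := hcop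
  calc ((s : G ⧸ N) ^ 2) = ((s : G ⧸ N) ^ 2) ^ (a * (1 - 2 * m) + b * 2 ^ k) := by
        rw [hab, zpow_one]
    _ = 1 := by
      rw [zpow_add, mul_comm a, mul_comm b, zpow_mul, zpow_mul, hm', one_zpow, one_mul]
      have : ((s : G ⧸ N) ^ 2) ^ ((2 : ℤ) ^ k) = 1 := by exact_mod_cast hpow
      rw [this, one_zpow]

omit [IsTopologicalGroup G] in
theorem H1.index_ker {χ : H1 G 2} {s : G} (hχ : χ.1 s = 1) : (H1.ker χ).index = 2 := by
  rw [Subgroup.index_eq_two_iff]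
  refine ⟨s, fun b => ?_⟩
  rw [H1.mem_ker, H1.mem_ker, (H1.map_mul χ), hχ]
  generalize χ.1 b = x
  revert x
  decide

theorem maxProPKernel_eq_ker {s : G} {χ : H1 G 2} (hχ : χ.1 s = 1)
    (hs : ∀ ψ : H1 G 2, ψ.1 s = 0 → ∀ g, ψ.1 g = 0) (hs2 : s ^ 2 ∈ descCentral G 2 3) :
    maxProPKernel G 2 = H1.ker χ := by
  have hidx := H1.index_ker hχ
  have hker : (H1.ker χ).Normal := Subgroup.normal_of_index_eq_two hidx
  refine le_antisymm (sInf_le ⟨hker, (H1.isOpen_ker χ), 1, by rw [hidx, pow_one]⟩) (le_sInf ?_)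
  rintro N ⟨hNn, hNo, k, hk⟩
  have hrel : (H1.ker χ).relIndex N ∣ 2 ^ 1 := by
    simpa [hidx] using Subgroup.relIndex_dvd_index_of_normal (H1.ker χ) N
  obtain ⟨j, -, hj⟩ := (Nat.dvd_prime_pow Nat.prime_two).1 hrel
  -- Intersecting with the kernel keeps `χ` defined on the quotient, so the parity of an exponent of
  -- `s` can be read off there.
  have hidx' : (H1.ker χ ⊓ N).index = 2 ^ (j + k) := by
    rw [← Subgroup.relIndex_mul_index (inf_le_right : (H1.ker χ) ⊓ N ≤ N), Subgroup.inf_relIndex_right,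
      hj, hk, pow_add]
  have hopen : IsOpen ((H1.ker χ ⊓ N : Subgroup G) : Set G) := (H1.isOpen_ker χ).inter hNo
  have htop := zpowers_mk_eq_top hs hopen hidx'
  have hsq := sq_mem_of_sq_mem_descCentral hopen hidx' htop hs2
  have hsq' : (s : G ⧸ (H1.ker χ ⊓ N)) ^ 2 = 1 := by
    rw [← QuotientGroup.mk_pow]
    exact (QuotientGroup.eq_one_iff _).2 hsq
  intro x hx
  obtain ⟨i, hi⟩ := Subgroup.mem_zpowers_iff.1 (htop ▸ Subgroup.mem_top (x : G ⧸ (H1.ker χ ⊓ N)))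
  obtain ⟨m, rfl | rfl⟩ := Int.even_or_odd' i
  · rw [zpow_mul, zpow_ofNat, hsq', one_zpow] at hi
    exact ((QuotientGroup.eq_one_iff x).1 hi.symm).2
  · rw [zpow_add, zpow_mul, zpow_ofNat, hsq', one_zpow, one_mul, zpow_one,
      QuotientGroup.eq] at hi
    have h0 : χ.1 (s⁻¹ * x) = 0 := hi.1
    rw [(H1.map_mul χ), (H1.map_inv χ), hχ, H1.mem_ker.1 hx] at h0
    exact absurd h0 (by decide)

theorem nonempty_quotient_ker_equiv {s : G} {χ : H1 G 2} (hχ : χ.1 s = 1) {N : Subgroup G} [N.Normal]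
    (hN : N = H1.ker χ) : Nonempty ((G ⧸ N) ≃ₜ* Multiplicative (ZMod 2)) := by
  let φ : G →* Multiplicative (ZMod 2) :=
    { toFun := fun g => Multiplicative.ofAdd (χ.1 g)
      map_one' := by rw [(H1.map_one χ)]; rfl
      map_mul' := fun g h => by rw [(H1.map_mul χ)]; rfl }
  have hsurj : Function.Surjective φ := fun x => by
    have hx : ∀ y : ZMod 2, y = 0 ∨ y = 1 := by decide
    rcases hx x.toAdd with h | h
    · exact ⟨1, by rw [_root_.map_one]; exact (congrArg Multiplicative.ofAdd h).symm⟩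
    · exact ⟨s, (congrArg Multiplicative.ofAdd (hχ.trans h.symm) : _)⟩
  have hk : N = φ.ker := hN.trans rfl
  let e : (G ⧸ N) ≃* Multiplicative (ZMod 2) :=
    (QuotientGroup.quotientMulEquivOfEq hk).trans
      (QuotientGroup.quotientKerEquivOfSurjective φ hsurj)
  have : DiscreteTopology (G ⧸ N) :=
    QuotientGroup.discreteTopology (hN ▸ H1.isOpen_ker χ)
  exact ⟨{ e with
    continuous_toFun := continuous_of_discreteTopology
    continuous_invFun := continuous_of_discreteTopology }⟩

end Two

/-! ### From a direct factor to the contradiction. -/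

/-- A direct factor `ℤ/n` of `G / G^(3)` gives an element of order dividing `n` which is central
modulo `G^(3)`, and a character of `G` with value `1` on it. -/
theorem exists_H1_of_direct_factor {n : ℕ} {G : Type*} [Group G] [TopologicalSpace G]
    [IsTopologicalGroup G] {K : Type*} [Group K] [TopologicalSpace K]
    (e : (G ⧸ descCentral G n 3) ≃ₜ* Multiplicative (ZMod n) × K) :
    ∃ (s : G) (χ : H1 G n), χ.1 s = 1 ∧ s ^ n ∈ descCentral G n 3 ∧
      ∀ g, (g * s)⁻¹ * (s * g) ∈ descCentral G n 3 := by
  obtain ⟨s, hs⟩ := QuotientGroup.mk_surjective (e.symm (Multiplicative.ofAdd 1, 1))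
  have hes : e (s : G ⧸ descCentral G n 3) = (Multiplicative.ofAdd 1, 1) := by
    rw [hs, ContinuousMulEquiv.apply_symm_apply]
  refine ⟨s, ⟨fun g => (e (g : G ⧸ descCentral G n 3)).1.toAdd, ?_, fun g h => ?_⟩, ?_, ?_,
    fun g => ?_⟩
  · exact continuous_toAdd.comp (continuous_fst.comp (e.continuous.comp QuotientGroup.continuous_mk))
  · change (e ((g * h : G) : G ⧸ descCentral G n 3)).1.toAdd = _
    rw [QuotientGroup.mk_mul, _root_.map_mul, Prod.fst_mul, toAdd_mul]
  · change (e (s : G ⧸ descCentral G n 3)).1.toAdd = 1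
    rw [hes, toAdd_ofAdd]
  · rw [← QuotientGroup.eq_one_iff, QuotientGroup.mk_pow, ← e.injective.eq_iff, _root_.map_pow,
      hes, _root_.map_one e, Prod.pow_mk, one_pow, ← ofAdd_nsmul, nsmul_one, ZMod.natCast_self]
    rfl
  · rw [← QuotientGroup.eq, QuotientGroup.mk_mul, QuotientGroup.mk_mul, ← e.injective.eq_iff,
      _root_.map_mul, _root_.map_mul, hes]
    ext1
    · exact mul_comm _ _
    · exact (mul_one _).trans (one_mul _).symm

end ProfiniteGalois

theorem proposition12p6 (p : ℕ) [Fact p.Prime]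
    (G : Type*) [Group G] [TopologicalSpace G] [IsTopologicalGroup G]
    [CompactSpace G] [TotallyDisconnectedSpace G]
    (hG : ProfiniteGalois.HasGaloisRelationType p p G)
    (h2 : p = 2 →
      IsEmpty (ProfiniteGalois.MaxProPQuotient G 2 ≃ₜ* Multiplicative (ZMod 2)))
    (K : Type*) [Group K] [TopologicalSpace K] :
    IsEmpty ((G ⧸ ProfiniteGalois.descCentral G p 3) ≃ₜ* Multiplicative (ZMod p) × K) := by
  refine ⟨fun e => ?_⟩
  obtain ⟨s, χ, hχ, hsp, hcent⟩ := ProfiniteGalois.exists_H1_of_direct_factor e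
  obtain ⟨ξ, hξ⟩ := hG.exists_xi
  have hp : p.Prime := Fact.out
  have : Fact (1 < p) := ⟨hp.one_lt⟩
  have hrel := ProfiniteGalois.sum_range_mul_add_one_eq_zero (hξ χ) hχ hsp
  rcases hp.eq_two_or_odd' with rfl | hodd
  · have hξs : ξ.1 s = 1 := by
      rw [Finset.sum_range_succ, Finset.sum_range_one, Nat.cast_zero, Nat.cast_one, zero_add,
        one_mul] at hrel
      exact (eq_neg_of_add_eq_zero_left hrel).trans (ZMod.neg_eq_self_mod_two 1)
    have hs := fun (ψ : ProfiniteGalois.H1 G 2) (hψ : ψ.1 s = 0) =>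
      ProfiniteGalois.eq_zero_of_apply_eq_zero (hξ ψ) hξs hcent hψ
    have hker := ProfiniteGalois.maxProPKernel_eq_ker hχ hs hsp
    obtain ⟨f⟩ := ProfiniteGalois.nonempty_quotient_ker_equiv hχ hker
    exact (h2 rfl).false f
  · have hsum : ∑ i ∈ Finset.range p, (i : ZMod p) = 0 := by
      obtain ⟨m, hm⟩ := hodd
      -- Oddness makes `(p - 1) / 2` an integer, so the sum is a multiple of `p`.
      have hid : p * (p - 1) / 2 = p * m := by
        rw [show p - 1 = 2 * m by omega, mul_left_comm, Nat.mul_div_cancel_left _ two_pos]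
      rw [← Nat.cast_sum, Finset.sum_range_id, hid, Nat.cast_mul, ZMod.natCast_self, zero_mul]
    rw [hsum, zero_mul, zero_add] at hrel
    exact one_ne_zero hrel
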